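/- **Setting.** For a finite set $S$ let $\mathcal P(S)$ be the set of probability vectors on $S$ with the distance $\|p-q\|_1=\sum_{s}|p(s)-q(s)|$ and its Borel $\sigma$-algebra. Let $\mathcal X$ (states) and $\mathcal U$ (actions) be finite sets, and let $P:\mathcal X\times\mathcal P(\mathcal X)\times\mathcal U\times\mathcal P(\mathcal U)\to\mathcal P(\mathcal X)$ (transition law) and $\tilde r:\mathcal X\times\mathcal P(\mathcal X)\times\mathcal U\times\mathcal P(\mathcal U)\to\mathbb R$ (reward). An admissible policy is a sequence $\pi=(\pi_t)_{t\ge 0}$ of measurable maps $\pi_t:\mathcal P(\mathcal X)\to\{h:\mathcal X\to\mathcal P(\mathcal U)\}$; write $\pi_t(x,\mu)=\pi_t(\mu)(x)\in\mathcal P(\mathcal U)$. Let $\gamma\in(0,1)$. *Mean-field control (MFC).* For $\mu\in\mathcal P(\mathcal X)$ put $$v^\pi(\mu)=\mathbb E\Big[\sum_{t=0}^\infty\gamma^t\,\tilde r(x_t,\mu_t,u_t,\nu_t)\Big],\qquad x_0\sim\mu,\quad u_t\sim\pi_t(x_t,\mu_t),\quad x_{t+1}\sim P(x_t,\mu_t,u_t,\nu_t),$$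 where $\mu_t$ and $\nu_t$ are the laws of $x_t$ and $u_t$, so that $\mu_0=\mu$ and $\nu_t=\sum_x\mu_t(x)\,\pi_t(x,\mu_t)$. *Cooperative $N$-agent problem (MARL).* For $N\ge1$ and an initial profile $x=(x^1,\dots,x^N)\in\mathcal X^N$ put $$u_N^\pi(x)=\frac1N\sum_{j=1}^N\mathbb E\Big[\sum_{t=0}^\infty\gamma^t\,\tilde r(x^{j}_t,\mu^N_t,u^{j}_t,\nu^N_t)\Big],\qquad x_0^j=x^j,\quad u^j_t\sim\pi_t(x^j_t,\mu^N_t),\quad x^j_{t+1}\sim P(x^j_t,\mu^N_t,u^j_t,\nu^N_t),$$ where $\mu^N_t=\frac1N\sum_j\mathbf 1(x^j_t=\cdot)$ and $\nu^N_t=\frac1N\sum_j\mathbf 1(u^j_t=\cdot)$ are the empirical distributions, the actions at time $t$ are drawn independently over the agents given the past and the current states, and the next states are drawn independently over the agents given the past and the current states and actions. Let $\mu^N=\frac1N\sum_j\mathbf 1(x^j=\cdot)$. **Corollary (optimal value approximation).** Let $L_P,L_{\tilde r},L_\Pi,\tilde R>0$ and $\gamma\in(0,1)$ satisfy $\gamma(2L_P+1)(1+L_\Pi)<1$.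 There is a constant $K>0$, depending only on $L_P,L_{\tilde r},L_\Pi,\tilde R,\gamma$, such that the following holds for all finite $\mathcal X,\mathcal U$, all $P,\tilde r$ with $$|\tilde r(x,\mu_1,u,\nu_1)|\le\tilde R,\qquad |\tilde r(x,\mu_1,u,\nu_1)-\tilde r(x,\mu_2,u,\nu_2)|\le L_{\tilde r}\big(\|\mu_1-\mu_2\|_1+\|\nu_1-\nu_2\|_1\big),$$ $$\|P(x,\mu_1,u,\nu_1)-P(x,\mu_2,u,\nu_2)\|_1\le L_P\big(\|\mu_1-\mu_2\|_1+\|\nu_1-\nu_2\|_1\big)$$ for all $x,u,\mu_1,\mu_2,\nu_1,\nu_2$, every set $\Pi$ of admissible policies (for instance the set of all of them), every $N\ge1$ and every initial profile $x\in\mathcal X^N$. Suppose that there are a maximizer of $\pi\mapsto v^\pi(\mu^N)$ over $\Pi$ and a maximizer of $\pi\mapsto u^\pi_N(x)$ over $\Pi$, each satisfying $$\|\pi_t(x,\mu_1)-\pi_t(x,\mu_2)\|_1\le L_\Pi\|\mu_1-\mu_2\|_1\qquad\text{for all }t\ge0,\ x\in\mathcal X,\ \mu_1,\mu_2\in\mathcal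 P(\mathcal X).$$ Then, for all $\pi^*\in\arg\max_{\pi\in\Pi}v^\pi(\mu^N)$ and $\widetilde\pi\in\arg\max_{\pi\in\Pi}u_N^\pi(x)$, $$\big|v^{\pi^*}(\mu^N)-u_N^{\widetilde\pi}(x)\big|\le\frac{C}{\sqrt N},\qquad C=K\big(\sqrt{|\mathcal X|}+\sqrt{|\mathcal U|}\big).$$ -/

import Mathlib

open MeasureTheory ProbabilityTheory Set

noncomputable section

namespace MeanField

/-- `Dist S` is the set of probability vectors on the finite set `S`; its measurable structure is
the one inherited from `S → ℝ`, i.e. the Borel σ-algebra of the `ℓ¹` distance. -/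
abbrev Dist (S : Type*) [Fintype S] : Type _ := stdSimplex ℝ S

namespace Dist

variable {S T : Type*} [Fintype S] [Fintype T]

/-- The `ℓ¹` distance `∑ s, |p s - q s|`. -/
def l1 (p q : Dist S) : ℝ := ∑ s, |p s - q s|

/-- The point mass at `s`. -/
def dirac [DecidableEq S] (s : S) : Dist S := ⟨Pi.single s 1, single_mem_stdSimplex ℝ s⟩

/-- The law of `(s, t)` when `s ∼ p` and, given `s`, `t ∼ k s`. -/
def joint (p : Dist S) (k : S → Dist T) : Dist (S × T) :=
  ⟨fun z => p z.1 * k z.1 z.2, fun z => mul_nonneg (p.2.1 z.1) ((k z.1).2.1 z.2), by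
    have h : ∀ s, ∑ t, k s t = 1 := fun s => (k s).2.2
    have h' : ∑ s, p s = 1 := p.2.2
    rw [Fintype.sum_prod_type]
    simp [← Finset.mul_sum, h, h']⟩

/-- The law of `t` when `s ∼ p` and, given `s`, `t ∼ k s`. -/
def bind (p : Dist S) (k : S → Dist T) : Dist T :=
  ⟨fun t => ∑ s, p s * k s t,
    fun t => Finset.sum_nonneg fun s _ => mul_nonneg (p.2.1 s) ((k s).2.1 t), by
    have h : ∀ s, ∑ t, k s t = 1 := fun s => (k s).2.2
    have h' : ∑ s, p s = 1 := p.2.2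
    rw [Finset.sum_comm]
    simp [← Finset.mul_sum, h, h']⟩

/-- The law of `N` independent draws, the `j`-th one from `p j`. -/
def indep {N : ℕ} (p : Fin N → Dist S) : Dist (Fin N → S) :=
  ⟨fun z => ∏ j, p j (z j), fun z => Finset.prod_nonneg fun j _ => (p j).2.1 (z j), by
    have h : ∀ j, ∑ s, p j s = 1 := fun j => (p j).2.2
    rw [← Fintype.prod_sum]
    simp [h]⟩

/-- The empirical distribution `s ↦ #{j | z j = s} / N` of a nonempty profile `z`. -/
def empirical [DecidableEq S] {N : ℕ} [NeZero N] (z : Fin N → S) : Dist S :=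
  ⟨fun s => (∑ j, if z j = s then (1 : ℝ) else 0) / N,
    fun s => div_nonneg (Finset.sum_nonneg fun j _ => by split_ifs <;> simp) (Nat.cast_nonneg _), by
    rw [← Finset.sum_div, Finset.sum_comm]
    simp [NeZero.ne N]⟩

/-- A probability vector as a measure. -/
def toMeasure [MeasurableSpace S] (p : Dist S) : Measure S :=
  ∑ s, ENNReal.ofReal (p s) • Measure.dirac s

instance [MeasurableSpace S] (p : Dist S) : IsProbabilityMeasure p.toMeasure where
  measure_univ := by
    have h : ∑ s, p s = 1 := p.2.2
    simp only [toMeasure, Measure.coe_finsetSum, Finset.sum_apply, Measure.smul_apply,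
      measure_univ, smul_eq_mul, mul_one]
    rw [← ENNReal.ofReal_sum_of_nonneg (f := fun s => p s) fun s _ => p.2.1 s, h,
      ENNReal.ofReal_one]

end Dist

/-! ### Markov chains on a finite set -/

section Chain

variable {S : Type*} [Fintype S] [MeasurableSpace S] [MeasurableSingletonClass S]

/-- The kernel that sends the history up to time `n` to the law of the state at time `n + 1`. -/
def chainKernel (k : ℕ → S → Dist S) (n : ℕ) : Kernel ((i : Finset.Iic n) → S) S :=
  Kernel.ofFunOfCountable fun h => (k n (h ⟨n, Finset.mem_Iic.2 le_rfl⟩)).toMeasure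

instance (k : ℕ → S → Dist S) (n : ℕ) : IsMarkovKernel (chainKernel k n) :=
  ⟨fun h => inferInstanceAs
    (IsProbabilityMeasure (k n (h ⟨n, Finset.mem_Iic.2 le_rfl⟩)).toMeasure)⟩

/-- The law, on the space of trajectories `ℕ → S`, of the Markov chain with initial law `p` whose
state at time `n + 1` is drawn from `k n s`, where `s` is the state at time `n`. -/
def chainLaw (p : Dist S) (k : ℕ → S → Dist S) : Measure (ℕ → S) :=
  Kernel.trajMeasure (X := fun _ => S) p.toMeasure (chainKernel k)

end Chain

/-! ### Policies and standing assumptions -/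

section Model

variable {X U : Type*} [Fintype X] [Fintype U]

/-- A policy `π = (π_t)`: at time `t` an agent in state `x` that sees the population state
distribution `μ` draws an action from `π t μ x`. -/
abbrev Policy (X U : Type*) [Fintype X] [Fintype U] : Type _ := ℕ → Dist X → X → Dist U

/-- The set of admissible policies: every `π t` is measurable. -/
def admissiblePolicies (X U : Type*) [Fintype X] [Fintype U] : Set (Policy X U) :=
  {π | ∀ t, Measurable (π t)}

/-- `‖π_t(μ₁, x) - π_t(μ₂, x)‖₁ ≤ L ‖μ₁ - μ₂‖₁` for all `t`, `x`, `μ₁`, `μ₂`. -/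
def PolicyLipschitz (L : ℝ) (π : Policy X U) : Prop :=
  ∀ t x μ₁ μ₂, (π t μ₁ x).l1 (π t μ₂ x) ≤ L * μ₁.l1 μ₂

/-- The reward `r(x, μ, u, ν)` is bounded by `R` and `L`-Lipschitz in `(μ, ν)`. -/
def RewardRegular (R L : ℝ) (r : X → Dist X → U → Dist U → ℝ) : Prop :=
  ∀ x u μ₁ μ₂ ν₁ ν₂, |r x μ₁ u ν₁| ≤ R ∧
    |r x μ₁ u ν₁ - r x μ₂ u ν₂| ≤ L * (μ₁.l1 μ₂ + ν₁.l1 ν₂)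

/-- The transition law `P(x, μ, u, ν)` is `L`-Lipschitz in `(μ, ν)`. -/
def TransitionLipschitz (L : ℝ) (P : X → Dist X → U → Dist U → Dist X) : Prop :=
  ∀ x u μ₁ μ₂ ν₁ ν₂, (P x μ₁ u ν₁).l1 (P x μ₂ u ν₂) ≤ L * (μ₁.l1 μ₂ + ν₁.l1 ν₂)

/-! ### The mean-field control problem -/

/-- The law of the action when the state has law `μ` and the action is drawn from `h x`. -/
def actionDist (μ : Dist X) (h : X → Dist U) : Dist U := μ.bind h

/-- The population state distributions `μ_t`: `μ_0 = μ`, and `μ_{t+1}` is the law of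
`x_{t+1} ∼ P(x_t, μ_t, u_t, ν_t)` when `x_t ∼ μ_t`, `u_t ∼ π_t(x_t, μ_t)` and `ν_t` is the law of
`u_t`. -/
def stateFlow (P : X → Dist X → U → Dist U → Dist X) (π : Policy X U) (μ : Dist X) : ℕ → Dist X
  | 0 => μ
  | t + 1 =>
    let m := stateFlow P π μ t
    (m.joint (π t m)).bind fun z => P z.1 m z.2 (actionDist m (π t m))

/-- The population action distributions `ν_t`. -/
def actionFlow (P : X → Dist X → U → Dist U → Dist X) (π : Policy X U) (μ : Dist X) (t : ℕ) :
    Dist U :=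
  actionDist (stateFlow P π μ t) (π t (stateFlow P π μ t))

variable [MeasurableSpace X] [MeasurableSingletonClass X]
  [MeasurableSpace U] [MeasurableSingletonClass U]

/-- The law of the trajectory `((x_t, u_t))_t` of the representative agent: `x_0 ∼ μ`,
`u_t ∼ π_t(x_t, μ_t)` and `x_{t+1} ∼ P(x_t, μ_t, u_t, ν_t)`. -/
def mfcLaw (P : X → Dist X → U → Dist U → Dist X) (π : Policy X U) (μ : Dist X) :
    Measure (ℕ → X × U) :=
  chainLaw (μ.joint (π 0 μ)) fun t z =>
    (P z.1 (stateFlow P π μ t) z.2 (actionFlow P π μ t)).joint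
      (π (t + 1) (stateFlow P π μ (t + 1)))

/-- `v^π(μ) = 𝔼[∑_t γ^t r(x_t, μ_t, u_t, ν_t)]`. -/
def mfcValue (γ : ℝ) (P : X → Dist X → U → Dist U → Dist X) (r : X → Dist X → U → Dist U → ℝ)
    (π : Policy X U) (μ : Dist X) : ℝ :=
  ∫ ω, ∑' t, γ ^ t * r (ω t).1 (stateFlow P π μ t) (ω t).2 (actionFlow P π μ t) ∂(mfcLaw P π μ)

/-- `π` maximizes `v^·(μ)` over the policy class `Pol`. -/
def IsMFCOptimal (γ : ℝ) (P : X → Dist X → U → Dist U → Dist X)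
    (r : X → Dist X → U → Dist U → ℝ) (Pol : Set (Policy X U)) (μ : Dist X)
    (π : Policy X U) : Prop :=
  π ∈ Pol ∧ ∀ π' ∈ Pol, mfcValue γ P r π' μ ≤ mfcValue γ P r π μ

/-! ### The cooperative `N`-agent problem -/

variable [DecidableEq X] [DecidableEq U] {N : ℕ} [NeZero N]

/-- The law of the trajectory `((x_t^j)_j, (u_t^j)_j)_t` of the `N` agents started from the state
profile `x`. With `μ_t^N`, `ν_t^N` the empirical distributions of the states and actions at time
`t`, the actions `u_t^j ∼ π_t(x_t^j, μ_t^N)` are drawn independently over `j` given the past and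
the current states, and the next states `x_{t+1}^j ∼ P(x_t^j, μ_t^N, u_t^j, ν_t^N)` are drawn
independently over `j` given the past and the current states and actions. -/
def marlLaw (P : X → Dist X → U → Dist U → Dist X) (π : Policy X U) (x : Fin N → X) :
    Measure (ℕ → (Fin N → X) × (Fin N → U)) :=
  chainLaw
    ((Dist.dirac x).joint fun y => Dist.indep fun j => π 0 (Dist.empirical y) (y j))
    fun t z =>
      (Dist.indep fun j => P (z.1 j) (Dist.empirical z.1) (z.2 j) (Dist.empirical z.2)).joint
        fun y => Dist.indep fun j => π (t + 1) (Dist.empirical y) (y j)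

/-- The value `v^{j,π} = 𝔼[∑_t γ^t r(x_t^j, μ_t^N, u_t^j, ν_t^N)]` of agent `j`. -/
def agentValue (γ : ℝ) (P : X → Dist X → U → Dist U → Dist X)
    (r : X → Dist X → U → Dist U → ℝ) (π : Policy X U) (x : Fin N → X) (j : Fin N) : ℝ :=
  ∫ ω, ∑' t, γ ^ t * r ((ω t).1 j) (Dist.empirical (ω t).1) ((ω t).2 j)
    (Dist.empirical (ω t).2) ∂(marlLaw P π x)

/-- The averaged value `u_N^π = (1/N) ∑_j v^{j,π}`. -/
def marlValue (γ : ℝ) (P : X → Dist X → U → Dist U → Dist X)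
    (r : X → Dist X → U → Dist U → ℝ) (π : Policy X U) (x : Fin N → X) : ℝ :=
  (1 / (N : ℝ)) * ∑ j, agentValue γ P r π x j

/-- `π` maximizes the averaged value over the policy class `Pol`. -/
def IsMARLOptimal (γ : ℝ) (P : X → Dist X → U → Dist U → Dist X)
    (r : X → Dist X → U → Dist U → ℝ) (Pol : Set (Policy X U)) (x : Fin N → X)
    (π : Policy X U) : Prop :=
  π ∈ Pol ∧ ∀ π' ∈ Pol, marlValue γ P r π' x ≤ marlValue γ P r π x

end Model

end MeanField

end

/-! Both optimal values are controlled by one estimate for a fixed Lipschitz policy,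
`abs_mfcValue_sub_marlValue_le`: its mean-field and `N`-agent values differ by `O(1/√N)`. Each
problem has a Lipschitz maximizer; testing each one in the other problem bounds the two optimal
values by each other up to that error, and other maximizers share the same values.

For a fixed policy, the values are discounted sums of expectations under one-time marginals, so only
the law at each time matters. Write `S = (2 L_P + 1)(1 + L)`. The mean-field step is `S`-Lipschitz
in `ℓ¹` (`l1_flowStep_le`). Given the current profile, the next empirical distribution misses the
mean-field step from the current one by `O(1/√N)` in expectation (`expect_l1_profileNext_le`),
because actions and next states are conditionally independent and variances add
(`expect_l1_mixture_le`). Iterating, the error at time `t` is `O(S ^ t / √N)`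
(`expect_l1_profileLaw_le`). Rewards are Lipschitz along the flow, and `γ S < 1` makes the
discounted errors summable. -/

noncomputable section

namespace MeanField

namespace Dist

/-! ### Finite expectations -/

section Expect

variable {S T V : Type*} [Fintype S] [Fintype T] [Fintype V]

theorem nonneg (p : Dist S) (s : S) : 0 ≤ p s := p.2.1 s

theorem sum_eq_one (p : Dist S) : ∑ s, p s = 1 := p.2.2

theorem le_one (p : Dist S) (s : S) : p s ≤ 1 := by
  rw [← p.sum_eq_one]
  exact Finset.single_le_sum (fun s _ => p.nonneg s) (Finset.mem_univ s)

theorem joint_apply (p : Dist S) (k : S → Dist T) (z : S × T) :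
    p.joint k z = p z.1 * k z.1 z.2 := rfl

theorem bind_apply (p : Dist S) (k : S → Dist T) (t : T) :
    p.bind k t = ∑ s, p s * k s t := rfl

theorem indep_apply {N : ℕ} (p : Fin N → Dist S) (z : Fin N → S) :
    indep p z = ∏ j, p j (z j) := rfl

theorem dirac_apply [DecidableEq S] (s t : S) : dirac s t = if s = t then 1 else 0 := by
  change (Pi.single s (1 : ℝ) : S → ℝ) t = _
  simp [Pi.single_apply, eq_comm]

theorem empirical_apply [DecidableEq S] {N : ℕ} [NeZero N] (z : Fin N → S) (s : S) :
    empirical z s = (∑ j, if z j = s then (1 : ℝ) else 0) / N := rfl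

/-- The expectation of `f` under the probability vector `p`. -/
def expect (p : Dist S) (f : S → ℝ) : ℝ := ∑ s, p s * f s

theorem expect_mono (p : Dist S) {f g : S → ℝ} (h : ∀ s, f s ≤ g s) :
    p.expect f ≤ p.expect g :=
  Finset.sum_le_sum fun s _ => mul_le_mul_of_nonneg_left (h s) (p.nonneg s)

theorem expect_add (p : Dist S) (f g : S → ℝ) :
    p.expect (fun s => f s + g s) = p.expect f + p.expect g := by
  simp [expect, mul_add, Finset.sum_add_distrib]

theorem expect_sub (p : Dist S) (f g : S → ℝ) :
    p.expect (fun s => f s - g s) = p.expect f - p.expect g := by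
  simp [expect, mul_sub, Finset.sum_sub_distrib]

theorem expect_const (p : Dist S) (c : ℝ) : p.expect (fun _ => c) = c := by
  simp [expect, ← Finset.sum_mul, p.sum_eq_one]

theorem expect_const_mul (p : Dist S) (c : ℝ) (f : S → ℝ) :
    p.expect (fun s => c * f s) = c * p.expect f := by
  simp only [expect, Finset.mul_sum]
  exact Finset.sum_congr rfl fun s _ => by ring

theorem expect_sum {ι : Type*} (a : Finset ι) (p : Dist S) (f : ι → S → ℝ) :
    p.expect (fun s => ∑ i ∈ a, f i s) = ∑ i ∈ a, p.expect (f i) := by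
  simp only [expect, Finset.mul_sum]
  exact Finset.sum_comm

theorem abs_expect_le_expect (p : Dist S) {f g : S → ℝ} (h : ∀ s, |f s| ≤ g s) :
    |p.expect f| ≤ p.expect g := by
  refine (Finset.abs_sum_le_sum_abs _ _).trans (Finset.sum_le_sum fun s _ => ?_)
  rw [abs_mul, abs_of_nonneg (p.nonneg s)]
  exact mul_le_mul_of_nonneg_left (h s) (p.nonneg s)

theorem abs_expect_le (p : Dist S) {f : S → ℝ} {c : ℝ} (h : ∀ s, |f s| ≤ c) :
    |p.expect f| ≤ c :=
  (p.abs_expect_le_expect h).trans_eq (p.expect_const c)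

theorem sq_expect_le (p : Dist S) (f : S → ℝ) :
    p.expect f ^ 2 ≤ p.expect fun s => f s ^ 2 := by
  -- This is the variance, with the square expanded so that linearity applies.
  have h : 0 ≤ p.expect fun s => (f s ^ 2 + (-2 * p.expect f) * f s) + p.expect f ^ 2 := by
    refine Finset.sum_nonneg fun s _ => mul_nonneg (p.nonneg s) ?_
    nlinarith [sq_nonneg (f s - p.expect f)]
  rw [expect_add, expect_add, expect_const_mul, expect_const] at h
  nlinarith

theorem expect_dirac [DecidableEq S] (s : S) (f : S → ℝ) : (dirac s).expect f = f s := by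
  simp [expect, dirac_apply]

theorem expect_joint (p : Dist S) (k : S → Dist T) (f : S × T → ℝ) :
    (p.joint k).expect f = p.expect fun s => (k s).expect fun t => f (s, t) := by
  simp only [expect, joint_apply, Fintype.sum_prod_type, Finset.mul_sum, mul_assoc]

theorem expect_bind (p : Dist S) (k : S → Dist T) (f : T → ℝ) :
    (p.bind k).expect f = p.expect fun s => (k s).expect f := by
  simp only [expect, bind_apply, Finset.mul_sum, Finset.sum_mul, mul_assoc]
  exact Finset.sum_comm

theorem bind_eq_expect (p : Dist S) (k : S → Dist T) (t : T) :
    p.bind k t = p.expect fun s => k s t := rfl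

theorem bind_dirac [DecidableEq S] (p : Dist S) : p.bind dirac = p := by
  ext s
  simp [bind_apply, dirac_apply]

theorem bind_joint (p : Dist S) (k : S → Dist T) (g : S × T → Dist V) :
    (p.joint k).bind g = p.bind fun s => (k s).bind fun t => g (s, t) := by
  ext v
  simp only [bind_eq_expect, expect_joint]

end Expect

/-! ### The `ℓ¹` distance and composition of laws -/

section L1

variable {S T : Type*} [Fintype S] [Fintype T]

theorem l1_nonneg (p q : Dist S) : 0 ≤ p.l1 q := Finset.sum_nonneg fun _ _ => abs_nonneg _

theorem l1_self (p : Dist S) : p.l1 p = 0 := by simp [l1]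

theorem l1_triangle (p q r : Dist S) : p.l1 r ≤ p.l1 q + q.l1 r := by
  simp only [l1, ← Finset.sum_add_distrib]
  exact Finset.sum_le_sum fun s _ => abs_sub_le _ _ _

theorem abs_expect_sub_expect_le (p q : Dist S) {f : S → ℝ} {c : ℝ} (h : ∀ s, |f s| ≤ c) :
    |p.expect f - q.expect f| ≤ c * p.l1 q := by
  simp only [expect, l1, ← Finset.sum_sub_distrib, Finset.mul_sum]
  refine (Finset.abs_sum_le_sum_abs _ _).trans (Finset.sum_le_sum fun s _ => ?_)
  rw [← sub_mul, abs_mul, mul_comm]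
  exact mul_le_mul_of_nonneg_right (h s) (abs_nonneg _)

/-- Split `p k - q k'` as `(p - q) k + q (k - k')`: the rows of `k` have mass one, and the second
part is a `q`-average of row distances. -/
theorem l1_joint_le (p q : Dist S) {k k' : S → Dist T} {c : ℝ} (h : ∀ s, (k s).l1 (k' s) ≤ c) :
    (p.joint k).l1 (q.joint k') ≤ p.l1 q + c := by
  have h1 : (p.joint k).l1 (q.joint k') ≤
      ∑ s, ∑ t, (|p s - q s| * k s t + q s * |k s t - k' s t|) := by
    simp only [l1, Fintype.sum_prod_type, joint_apply]
    refine Finset.sum_le_sum fun s _ => Finset.sum_le_sum fun t _ => ?_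
    have : p s * k s t - q s * k' s t = (p s - q s) * k s t + q s * (k s t - k' s t) := by ring
    rw [this]
    refine (abs_add_le _ _).trans (le_of_eq ?_)
    rw [abs_mul, abs_mul, abs_of_nonneg (nonneg _ _), abs_of_nonneg (nonneg q s)]
  refine h1.trans ?_
  simp only [Finset.sum_add_distrib, ← Finset.mul_sum, sum_eq_one, mul_one]
  exact add_le_add le_rfl ((q.expect_mono h).trans_eq (q.expect_const c))

/-- Passing to a marginal cannot increase the `ℓ¹` distance. -/
theorem l1_bind_le_l1_joint (p q : Dist S) (k k' : S → Dist T) :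
    (p.bind k).l1 (q.bind k') ≤ (p.joint k).l1 (q.joint k') := by
  simp only [l1, Fintype.sum_prod_type_right, joint_apply, bind_apply, ← Finset.sum_sub_distrib]
  exact Finset.sum_le_sum fun t _ => Finset.abs_sum_le_sum_abs _ _

theorem l1_bind_le (p q : Dist S) {k k' : S → Dist T} {c : ℝ} (h : ∀ s, (k s).l1 (k' s) ≤ c) :
    (p.bind k).l1 (q.bind k') ≤ p.l1 q + c :=
  (l1_bind_le_l1_joint p q k k').trans (l1_joint_le p q h)

end L1

/-! ### Uniform mixtures and empirical distributions -/

section Mixture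

variable {S T : Type*} [Fintype S] [Fintype T] {N : ℕ} [NeZero N]

/-- The uniform mixture of `N` probability vectors. -/
def mixture (d : Fin N → Dist T) : Dist T :=
  ⟨fun t => (∑ j, d j t) / N,
    fun t => div_nonneg (Finset.sum_nonneg fun j _ => (d j).nonneg t) (Nat.cast_nonneg _), by
    rw [← Finset.sum_div, Finset.sum_comm]
    simp [NeZero.ne N]⟩

theorem mixture_apply (d : Fin N → Dist T) (t : T) : mixture d t = (∑ j, d j t) / N := rfl

/-- Lets a single concentration bound for mixtures cover both empirical distributions and averaged
transition laws. -/
theorem empirical_eq_mixture [DecidableEq S] (z : Fin N → S) :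
    empirical z = mixture fun j => dirac (z j) := by
  ext s
  simp [empirical_apply, mixture_apply, dirac_apply]

theorem expect_mixture (d : Fin N → Dist T) (f : T → ℝ) :
    (mixture d).expect f = (∑ j, (d j).expect f) / N := by
  simp only [expect, mixture_apply, Finset.sum_div, Finset.sum_mul]
  rw [Finset.sum_comm]
  exact Finset.sum_congr rfl fun j _ => Finset.sum_congr rfl fun t _ => by ring

theorem expect_empirical [DecidableEq S] (z : Fin N → S) (f : S → ℝ) :
    (empirical z).expect f = (∑ j, f (z j)) / N := by
  simp only [empirical_eq_mixture, expect_mixture, expect_dirac]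

theorem bind_empirical [DecidableEq S] (z : Fin N → S) (k : S → Dist T) :
    (empirical z).bind k = mixture fun j => k (z j) := by
  ext t
  rw [bind_eq_expect, expect_empirical, mixture_apply]

theorem l1_mixture_le {d d' : Fin N → Dist T} {c : ℝ} (h : ∀ j, (d j).l1 (d' j) ≤ c) :
    (mixture d).l1 (mixture d') ≤ c := by
  have hN : (0 : ℝ) < N := Nat.cast_pos.2 (NeZero.pos N)
  have h1 : (mixture d).l1 (mixture d') ≤ (∑ j, (d j).l1 (d' j)) / N := by
    simp only [l1, mixture_apply]
    rw [Finset.sum_comm, Finset.sum_div]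
    refine Finset.sum_le_sum fun t _ => ?_
    rw [← sub_div, abs_div, abs_of_pos hN, ← Finset.sum_sub_distrib]
    gcongr
    exact Finset.abs_sum_le_sum_abs _ _
  refine h1.trans ?_
  rw [div_le_iff₀ hN]
  refine (Finset.sum_le_sum fun j _ => h j).trans_eq ?_
  simp [mul_comm]

end Mixture

/-! ### Independent draws and concentration in `ℓ¹` -/

section Indep

variable {S T : Type*} [Fintype S] [Fintype T] {N : ℕ}

theorem expect_indep_prod (p : Fin N → Dist S) (F : Fin N → S → ℝ) :
    (indep p).expect (fun z => ∏ j, F j (z j)) = ∏ j, (p j).expect (F j) := by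
  simp only [expect, indep_apply, ← Finset.prod_mul_distrib]
  exact (Fintype.prod_sum fun j s => p j s * F j s).symm

theorem expect_indep_apply (p : Fin N → Dist S) (i : Fin N) (f : S → ℝ) :
    (indep p).expect (fun z => f (z i)) = (p i).expect f := by
  -- A function of one coordinate is a product whose other factors are 1.
  have h := expect_indep_prod p fun j s => if j = i then f s else 1
  simp only [Finset.prod_ite_eq', Finset.mem_univ, if_true] at h
  rw [h, Finset.prod_eq_single i]
  · simp
  · intro j _ hj
    simp [hj, expect_const]
  · simp

theorem expect_indep_mul (p : Fin N → Dist S) {i k : Fin N} (hik : i ≠ k) (f g : S → ℝ) :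
    (indep p).expect (fun z => f (z i) * g (z k)) = (p i).expect f * (p k).expect g := by
  have h := expect_indep_prod p fun j s => (if j = i then f s else 1) * (if j = k then g s else 1)
  simp only [Finset.prod_mul_distrib, Finset.prod_ite_eq', Finset.mem_univ, if_true] at h
  rw [h, Finset.prod_eq_mul i k hik]
  · simp [hik, hik.symm]
  · intro j _ hj
    simp [hj, expect_const]
  · simp
  · simp

/-- The variance of a sum of centred independent variables is the sum of the variances. -/
theorem expect_indep_sum_sq (p : Fin N → Dist S) (g : Fin N → S → ℝ)
    (hg : ∀ j, (p j).expect (g j) = 0) :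
    (indep p).expect (fun z => (∑ j, g j (z j)) ^ 2) = ∑ j, (p j).expect fun s => g j s ^ 2 := by
  simp only [sq, Finset.sum_mul_sum, expect_sum]
  refine Finset.sum_congr rfl fun i _ => ?_
  rw [Finset.sum_eq_single i]
  · exact expect_indep_apply p i fun s => g i s * g i s
  · intro k _ hk
    rw [expect_indep_mul p hk.symm, hg, zero_mul]
  · simp

/-- The mixture of `N` independent random probability vectors is within `√(|T| / N)` of its mean
in expected `ℓ¹` distance. -/
theorem expect_l1_mixture_le [NeZero N] (p : Fin N → Dist S) (f : Fin N → S → Dist T) :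
    (indep p).expect (fun z => (mixture fun j => f j (z j)).l1 (mixture fun j => (p j).bind (f j)))
      ≤ √(Fintype.card T : ℝ) / √(N : ℝ) := by
  have hN : (0 : ℝ) < N := Nat.cast_pos.2 (NeZero.pos N)
  set m : Fin N → T → ℝ := fun j t => (p j).bind (f j) t with hm
  -- Values lie in `[0, 1]`, so the variance is at most the mean. Summed over `t` the means give 1
  -- for each `j`, so no further factor `|T|` arises.
  have hvar : ∀ j t, (p j).expect (fun s => (f j s t - m j t) ^ 2) ≤ m j t := by
    intro j t
    have hmean : (p j).expect (fun s => f j s t) = m j t := rfl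
    calc (p j).expect (fun s => (f j s t - m j t) ^ 2)
        ≤ (p j).expect fun s => f j s t + ((-2 * m j t) * f j s t + m j t ^ 2) := by
          refine expect_mono _ fun s => ?_
          nlinarith [(f j s).nonneg t, (f j s).le_one t]
      _ = m j t - m j t ^ 2 := by
          rw [expect_add, expect_add, expect_const_mul, expect_const, hmean]; ring
      _ ≤ m j t := by nlinarith [sq_nonneg (m j t)]
  have hcoord : ∀ t, (indep p).expect (fun z => ((mixture fun j => f j (z j)) t -
      (mixture fun j => (p j).bind (f j)) t) ^ 2) ≤ (∑ j, m j t) / N ^ 2 := by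
    intro t
    have h := expect_indep_sum_sq p (fun j s => f j s t - m j t) fun j => by
      rw [expect_sub, expect_const]
      exact sub_self _
    have heq : ∀ z : Fin N → S, ((mixture fun j => f j (z j)) t -
        (mixture fun j => (p j).bind (f j)) t) ^ 2 =
        (1 / (N : ℝ) ^ 2) * (∑ j, (f j (z j) t - m j t)) ^ 2 := by
      intro z
      rw [mixture_apply, mixture_apply, Finset.sum_sub_distrib]
      ring
    simp only [heq]
    rw [expect_const_mul, h, one_div_mul_eq_div]
    gcongr with j _
    exact hvar j t
  -- Jensen moves the square inside; Cauchy–Schwarz over `T` then costs the factor `|T|`.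
  have htot : (indep p).expect (fun z => (mixture fun j => f j (z j)).l1
      (mixture fun j => (p j).bind (f j))) ^ 2 ≤ Fintype.card T / N := by
    refine (sq_expect_le _ _).trans ?_
    calc _ ≤ (indep p).expect (fun z => (Fintype.card T : ℝ) * ∑ t,
          ((mixture fun j => f j (z j)) t - (mixture fun j => (p j).bind (f j)) t) ^ 2) := by
          refine expect_mono _ fun z => ?_
          refine (sq_sum_le_card_mul_sum_sq).trans_eq ?_
          simp [sq_abs]
      _ ≤ (Fintype.card T : ℝ) * ∑ t, (∑ j, m j t) / N ^ 2 := by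
          rw [expect_const_mul, expect_sum]
          gcongr with t _
          exact hcoord t
      _ = Fintype.card T / N := by
          rw [← Finset.sum_div, Finset.sum_comm]
          simp only [hm, sum_eq_one]
          simp
          field_simp
  rw [← Real.sqrt_div (Nat.cast_nonneg _)]
  exact Real.le_sqrt_of_sq_le htot

/-- The empirical distribution of independent draws is close to the mixture of their laws. -/
theorem expect_l1_empirical_le [NeZero N] [DecidableEq S] (p : Fin N → Dist S) :
    (indep p).expect (fun z => (empirical z).l1 (mixture p)) ≤
      √(Fintype.card S : ℝ) / √(N : ℝ) := by
  simpa only [bind_dirac, ← empirical_eq_mixture] using expect_l1_mixture_le p fun _ => dirac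

end Indep

end Dist

/-! ### One-time marginals of the trajectory measure -/

section Marginals

variable {S : Type*} [Fintype S] [MeasurableSpace S] [MeasurableSingletonClass S]

theorem Dist.integral_toMeasure (p : Dist S) (f : S → ℝ) :
    ∫ s, f s ∂p.toMeasure = p.expect f := by
  rw [Dist.toMeasure, integral_finsetSum_measure fun s _ =>
    (integrable_dirac (by simp)).smul_measure ENNReal.ofReal_ne_top]
  refine Finset.sum_congr rfl fun s _ => ?_
  rw [integral_smul_measure, integral_dirac, ENNReal.toReal_ofReal (p.nonneg s), smul_eq_mul]

instance (p : Dist S) (k : ℕ → S → Dist S) : IsProbabilityMeasure (chainLaw p k) :=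
  inferInstanceAs (IsProbabilityMeasure (Kernel.trajMeasure _ _))

theorem map_zero_chainLaw (p : Dist S) (k : ℕ → S → Dist S) :
    (chainLaw p k).map (fun ω => ω 0) = p.toMeasure := by
  have h : (chainLaw p k).map (Preorder.frestrictLe 0) =
      p.toMeasure.map (MeasurableEquiv.piUnique fun _ : Finset.Iic 0 => S).symm := by
    rw [chainLaw, Kernel.trajMeasure, Measure.map_comp _ _ (by fun_prop),
      Kernel.traj_map_frestrictLe, Kernel.partialTraj_self, Measure.id_comp]
  have h0 : (fun ω : ℕ → S => ω 0) =
      (MeasurableEquiv.piUnique fun _ : Finset.Iic 0 => S) ∘ Preorder.frestrictLe 0 := rfl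
  rw [h0, ← Measure.map_map (by fun_prop) (by fun_prop), h, Measure.map_map (by fun_prop)
    (by fun_prop), MeasurableEquiv.self_comp_symm, Measure.map_id]

theorem integral_chainLaw_zero (p : Dist S) (k : ℕ → S → Dist S) (f : S → ℝ) :
    ∫ ω, f (ω 0) ∂(chainLaw p k) = p.expect f := by
  rw [← Dist.integral_toMeasure, ← map_zero_chainLaw p k,
    integral_map (measurable_pi_apply 0).aemeasurable (Measurable.of_discrete.aestronglyMeasurable)]

/-- Markov property: the history and the next state are jointly distributed as a composition-product
whose kernel reads only the last state. -/
theorem integral_chainLaw_succ (p : Dist S) (k : ℕ → S → Dist S) (t : ℕ) (f : S → ℝ) :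
    ∫ ω, f (ω (t + 1)) ∂(chainLaw p k) = ∫ ω, (k t (ω t)).expect f ∂(chainLaw p k) := by
  have h := Kernel.map_frestrictLe_trajMeasure_compProd_eq_map_trajMeasure (X := fun _ => S)
    (μ₀ := p.toMeasure) (κ := chainKernel k) (a := t)
  have h1 : ∫ ω, f (ω (t + 1)) ∂(chainLaw p k) =
      ∫ z, f z.2 ∂((chainLaw p k).map fun x => (Preorder.frestrictLe t x, x (t + 1))) := by
    rw [integral_map (by fun_prop)]
    exact ((Measurable.of_discrete (f := f)).comp measurable_snd).aestronglyMeasurable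
  rw [h1, chainLaw, ← h, Measure.integral_compProd, integral_map (by fun_prop)]
  · refine integral_congr_ae (Filter.Eventually.of_forall fun ω => ?_)
    exact Dist.integral_toMeasure _ f
  · exact Measurable.of_discrete.aestronglyMeasurable
  · exact .of_finite

/-- Expectation of a discounted sum of bounded functions of the successive states. -/
theorem hasSum_integral_chainLaw (p : Dist S) (k : ℕ → S → Dist S) {γ R : ℝ} (hγ : 0 ≤ γ)
    (hγ1 : γ < 1) (f : ℕ → S → ℝ) (hf : ∀ t s, |f t s| ≤ R) :
    HasSum (fun t => γ ^ t * ∫ ω, f t (ω t) ∂(chainLaw p k))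
      (∫ ω, ∑' t, γ ^ t * f t (ω t) ∂(chainLaw p k)) := by
  have hmeas : ∀ t, Measurable fun ω : ℕ → S => γ ^ t * f t (ω t) := fun t =>
    (Measurable.of_discrete (f := fun s => γ ^ t * f t s)).comp (measurable_pi_apply t)
  have hbound : ∀ t (ω : ℕ → S), ‖γ ^ t * f t (ω t)‖ ≤ γ ^ t * R := fun t ω => by
    rw [norm_mul, norm_pow, Real.norm_eq_abs, Real.norm_eq_abs, abs_of_nonneg hγ]
    exact mul_le_mul_of_nonneg_left (hf t _) (pow_nonneg hγ t)
  have hint : ∀ t, Integrable (fun ω : ℕ → S => γ ^ t * f t (ω t)) (chainLaw p k) := fun t =>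
    .of_bound (hmeas t).aestronglyMeasurable _ (Filter.Eventually.of_forall (hbound t))
  have h := hasSum_integral_of_summable_integral_norm hint
    (.of_nonneg_of_le (fun t => integral_nonneg fun ω => norm_nonneg _) (fun t => by
      simpa using integral_mono (hint t).norm (integrable_const (γ ^ t * R)) (hbound t))
      ((summable_geometric_of_lt_one hγ hγ1).mul_right R))
  simpa only [integral_const_mul] using h

end Marginals

/-! ### Chains alternating states and actions -/

section TwoStage

variable {S A : Type*} [Fintype S] [Fintype A]

/-- The law of the state at time `t` when actions are drawn from `h t` and then states
from `g t`. -/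
def twoStageLaw (p : Dist S) (h : ℕ → S → Dist A) (g : ℕ → S × A → Dist S) : ℕ → Dist S
  | 0 => p
  | t + 1 => ((twoStageLaw p h g t).joint (h t)).bind (g t)

variable [MeasurableSpace S] [MeasurableSingletonClass S] [MeasurableSpace A]
  [MeasurableSingletonClass A]

/-- Actions are drawn afresh from the current state, so the state law determines the pair law. The
induction is over all `f`, since its step replaces `f` by a conditional expectation. -/
theorem integral_twoStage (p : Dist S) (h : ℕ → S → Dist A) (g : ℕ → S × A → Dist S) (t : ℕ)
    (f : S × A → ℝ) :
    ∫ ω, f (ω t) ∂(chainLaw (p.joint (h 0)) fun t z => (g t z).joint (h (t + 1))) =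
      ((twoStageLaw p h g t).joint (h t)).expect f := by
  induction t generalizing f with
  | zero => exact integral_chainLaw_zero _ _ f
  | succ t ih =>
    rw [integral_chainLaw_succ, ih fun z => ((g t z).joint (h (t + 1))).expect f, Dist.expect_joint (twoStageLaw p h g (t + 1)), twoStageLaw,
      Dist.expect_bind]
    simp only [Dist.expect_joint]

end TwoStage

/-! ### Values as discounted sums over marginals: the `N`-agent problem -/

section Dynamics

variable {X U : Type*} [Fintype X] [Fintype U]
  (P : X → Dist X → U → Dist U → Dist X) (r : X → Dist X → U → Dist U → ℝ) (π : Policy X U)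

/-- One step of the mean-field dynamics under the decision rule `h`. -/
def flowStep (h : Dist X → X → Dist U) (μ : Dist X) : Dist X :=
  (μ.joint (h μ)).bind fun z => P z.1 μ z.2 (actionDist μ (h μ))

/-- The expected mean-field reward of the decision rule `h` at the state distribution `μ`. -/
def flowReward (h : Dist X → X → Dist U) (μ : Dist X) : ℝ :=
  (μ.joint (h μ)).expect fun z => r z.1 μ z.2 (actionDist μ (h μ))

/-- Consistency: an agent driven by the population flow has that flow as its own law. -/
theorem twoStageLaw_eq_stateFlow (μ : Dist X) (t : ℕ) :
    twoStageLaw μ (fun t => π t (stateFlow P π μ t))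
      (fun t z => P z.1 (stateFlow P π μ t) z.2 (actionFlow P π μ t)) t = stateFlow P π μ t := by
  induction t with
  | zero => rfl
  | succ t ih => rw [twoStageLaw, ih]; rfl

variable [DecidableEq X] [DecidableEq U] {N : ℕ} [NeZero N]

/-- The law of the action profile of `N` agents in the state profile `y`. -/
def profileActions (h : Dist X → X → Dist U) (y : Fin N → X) : Dist (Fin N → U) :=
  Dist.indep fun j => h (Dist.empirical y) (y j)

/-- The law of the next state profile of `N` agents. -/
def profileNext (z : (Fin N → X) × (Fin N → U)) : Dist (Fin N → X) :=
  Dist.indep fun j => P (z.1 j) (Dist.empirical z.1) (z.2 j) (Dist.empirical z.2)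

/-- The law of the state profile of `N` agents at time `t`. -/
def profileLaw (x : Fin N → X) : ℕ → Dist (Fin N → X) :=
  twoStageLaw (Dist.dirac x) (fun t => profileActions (π t)) fun _ => profileNext P

/-- The expected average reward of `N` agents in the state profile `y`. -/
def profileReward (h : Dist X → X → Dist U) (y : Fin N → X) : ℝ :=
  (profileActions h y).expect fun u =>
    (∑ j, r (y j) (Dist.empirical y) (u j) (Dist.empirical u)) / N

variable [MeasurableSpace X] [MeasurableSingletonClass X]
  [MeasurableSpace U] [MeasurableSingletonClass U]

theorem hasSum_marlValue {γ R : ℝ} (hγ : 0 ≤ γ) (hγ1 : γ < 1)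
    (hr : ∀ x μ u ν, |r x μ u ν| ≤ R) (x : Fin N → X) :
    HasSum (fun t => γ ^ t * (profileLaw P π x t).expect (profileReward r (π t)))
      (marlValue γ P r π x) := by
  have h : ∀ j, HasSum (fun t => γ ^ t * ∫ ω, r ((ω t).1 j) (Dist.empirical (ω t).1) ((ω t).2 j)
      (Dist.empirical (ω t).2) ∂(marlLaw P π x)) (agentValue γ P r π x j) := fun j =>
    hasSum_integral_chainLaw _ _ hγ hγ1
      (fun _ (z : (Fin N → X) × (Fin N → U)) => r (z.1 j) (Dist.empirical z.1) (z.2 j) (Dist.empirical z.2))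
      (fun t z => hr _ _ _ _)
  have h2 := (hasSum_sum fun j (_ : j ∈ Finset.univ) => h j).mul_left (1 / (N : ℝ))
  refine h2.congr_fun fun t => ?_
  have h3 : ∀ j, ∫ ω, r ((ω t).1 j) (Dist.empirical (ω t).1) ((ω t).2 j)
      (Dist.empirical (ω t).2) ∂(marlLaw P π x) = (profileLaw P π x t).expect fun y =>
        (profileActions (π t) y).expect fun u =>
          r (y j) (Dist.empirical y) (u j) (Dist.empirical u) := fun j =>
    (integral_twoStage (Dist.dirac x) (fun t => profileActions (π t)) (fun _ => profileNext P) t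
      (fun z => r (z.1 j) (Dist.empirical z.1) (z.2 j) (Dist.empirical z.2))).trans
      (Dist.expect_joint _ _ _)
  have h4 : profileReward r (π t) = fun y : Fin N → X => (1 / (N : ℝ)) * ∑ j,
      (profileActions (π t) y).expect fun u =>
        r (y j) (Dist.empirical y) (u j) (Dist.empirical u) := by
    ext y
    simp only [profileReward, div_eq_inv_mul, Dist.expect_const_mul, Dist.expect_sum, mul_one]
  rw [h4, Dist.expect_const_mul, Dist.expect_sum]
  simp only [h3, ← Finset.mul_sum]
  ring

end Dynamics

/-! ### Values as discounted sums over marginals: mean-field control -/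

section MeanFieldValue

variable {X U : Type*} [Fintype X] [Fintype U] [MeasurableSpace X] [MeasurableSingletonClass X]
  [MeasurableSpace U] [MeasurableSingletonClass U]
  (P : X → Dist X → U → Dist U → Dist X) (r : X → Dist X → U → Dist U → ℝ) (π : Policy X U)

theorem hasSum_mfcValue {γ R : ℝ} (hγ : 0 ≤ γ) (hγ1 : γ < 1)
    (hr : ∀ x μ u ν, |r x μ u ν| ≤ R) (μ : Dist X) :
    HasSum (fun t => γ ^ t * flowReward r (π t) (stateFlow P π μ t)) (mfcValue γ P r π μ) := by
  have h := hasSum_integral_chainLaw (μ.joint (π 0 (stateFlow P π μ 0)))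
    (fun t z => (P z.1 (stateFlow P π μ t) z.2 (actionFlow P π μ t)).joint
      (π (t + 1) (stateFlow P π μ (t + 1)))) hγ hγ1
    (fun t z => r z.1 (stateFlow P π μ t) z.2 (actionFlow P π μ t)) (fun t z => hr _ _ _ _)
  have h' : ∀ t, ∫ ω, r (ω t).1 (stateFlow P π μ t) (ω t).2 (actionFlow P π μ t)
      ∂(mfcLaw P π μ) = flowReward r (π t) (stateFlow P π μ t) := fun t => by
    have := integral_twoStage μ (fun t => π t (stateFlow P π μ t))
      (fun t z => P z.1 (stateFlow P π μ t) z.2 (actionFlow P π μ t)) t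
      (fun z => r z.1 (stateFlow P π μ t) z.2 (actionFlow P π μ t))
    rw [twoStageLaw_eq_stateFlow] at this
    exact this
  simp only [← h']
  exact h

end MeanFieldValue

/-! ### Lipschitz bounds for the mean-field step and reward -/

section FlowLipschitz

variable {X U : Type*} [Fintype X] [Fintype U]
  {P : X → Dist X → U → Dist U → Dist X} {r : X → Dist X → U → Dist U → ℝ}
  {h : Dist X → X → Dist U} {L_P L_r R L : ℝ}

theorem l1_actionDist_le (hh : ∀ x μ₁ μ₂, (h μ₁ x).l1 (h μ₂ x) ≤ L * μ₁.l1 μ₂) (μ₁ μ₂ : Dist X) :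
    (actionDist μ₁ (h μ₁)).l1 (actionDist μ₂ (h μ₂)) ≤ (1 + L) * μ₁.l1 μ₂ :=
  (Dist.l1_bind_le μ₁ μ₂ fun x => hh x μ₁ μ₂).trans_eq (by ring)

theorem l1_joint_decision_le (hh : ∀ x μ₁ μ₂, (h μ₁ x).l1 (h μ₂ x) ≤ L * μ₁.l1 μ₂)
    (μ₁ μ₂ : Dist X) : (μ₁.joint (h μ₁)).l1 (μ₂.joint (h μ₂)) ≤ (1 + L) * μ₁.l1 μ₂ :=
  (Dist.l1_joint_le μ₁ μ₂ fun x => hh x μ₁ μ₂).trans_eq (by ring)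

theorem l1_flowStep_le (hL_P : 0 ≤ L_P) (hL : 0 ≤ L) (hP : TransitionLipschitz L_P P)
    (hh : ∀ x μ₁ μ₂, (h μ₁ x).l1 (h μ₂ x) ≤ L * μ₁.l1 μ₂) (μ₁ μ₂ : Dist X) :
    (flowStep P h μ₁).l1 (flowStep P h μ₂) ≤ (2 * L_P + 1) * (1 + L) * μ₁.l1 μ₂ := by
  have h1 := Dist.l1_bind_le (μ₁.joint (h μ₁)) (μ₂.joint (h μ₂)) fun z =>
    hP z.1 z.2 μ₁ μ₂ (actionDist μ₁ (h μ₁)) (actionDist μ₂ (h μ₂))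
  have h2 := l1_joint_decision_le hh μ₁ μ₂
  have h3 := mul_le_mul_of_nonneg_left (l1_actionDist_le hh μ₁ μ₂) hL_P
  -- The estimates give `(1 + L) + L_P (2 + L)`; adding the slack `L_P L` produces the factored
  -- constant of the discount condition.
  have h4 : 0 ≤ L_P * L * μ₁.l1 μ₂ := mul_nonneg (mul_nonneg hL_P hL) (Dist.l1_nonneg _ _)
  refine h1.trans ?_
  linarith

/-- Change the state-action law first, at cost `R`, then the integrand, at cost `L_r`. -/
theorem abs_flowReward_sub_le (hL_r : 0 ≤ L_r) (hR : 0 ≤ R) (hr : RewardRegular R L_r r)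
    (hh : ∀ x μ₁ μ₂, (h μ₁ x).l1 (h μ₂ x) ≤ L * μ₁.l1 μ₂) (μ₁ μ₂ : Dist X) :
    |flowReward r h μ₁ - flowReward r h μ₂| ≤
      (R * (1 + L) + L_r * (2 + L)) * μ₁.l1 μ₂ := by
  set ν₁ := actionDist μ₁ (h μ₁)
  set ν₂ := actionDist μ₂ (h μ₂)
  have h1 : |(μ₁.joint (h μ₁)).expect (fun z => r z.1 μ₁ z.2 ν₁) -
      (μ₂.joint (h μ₂)).expect fun z => r z.1 μ₁ z.2 ν₁| ≤ R * ((1 + L) * μ₁.l1 μ₂) :=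
    (Dist.abs_expect_sub_expect_le _ _ fun z => (hr z.1 z.2 μ₁ μ₁ ν₁ ν₁).1).trans
      (mul_le_mul_of_nonneg_left (l1_joint_decision_le hh μ₁ μ₂) hR)
  have h2 : |(μ₂.joint (h μ₂)).expect (fun z => r z.1 μ₁ z.2 ν₁) -
      (μ₂.joint (h μ₂)).expect fun z => r z.1 μ₂ z.2 ν₂| ≤ L_r * (μ₁.l1 μ₂ + ν₁.l1 ν₂) := by
    rw [← Dist.expect_sub]
    exact Dist.abs_expect_le _ fun z => (hr z.1 z.2 μ₁ μ₂ ν₁ ν₂).2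
  have h3 := mul_le_mul_of_nonneg_left (l1_actionDist_le hh μ₁ μ₂) hL_r
  refine (abs_sub_le _ _ _).trans ((add_le_add h1 h2).trans ?_)
  linarith

end FlowLipschitz

/-! ### `N` agents against the mean-field flow -/

section Profile

variable {X U : Type*} [Fintype X] [Fintype U] [DecidableEq X]
  {N : ℕ} [NeZero N] {P : X → Dist X → U → Dist U → Dist X} {r : X → Dist X → U → Dist U → ℝ}
  {L_P L_r R : ℝ} (h : Dist X → X → Dist U)

theorem actionDist_empirical (y : Fin N → X) :
    actionDist (Dist.empirical y) (h (Dist.empirical y)) =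
      Dist.mixture fun j => h (Dist.empirical y) (y j) :=
  Dist.bind_empirical _ _

variable [DecidableEq U]

theorem expect_l1_empirical_action_le (y : Fin N → X) :
    (profileActions h y).expect (fun u => (Dist.empirical u).l1
      (actionDist (Dist.empirical y) (h (Dist.empirical y)))) ≤
      √(Fintype.card U : ℝ) / √(N : ℝ) := by
  rw [actionDist_empirical]
  exact Dist.expect_l1_empirical_le _

/-- One-step error between the empirical distribution of `N` agents and the mean-field flow. -/
theorem expect_l1_profileNext_le (hL_P : 0 ≤ L_P) (hP : TransitionLipschitz L_P P)
    (y : Fin N → X) :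
    (profileActions h y).expect (fun u => (profileNext P (y, u)).expect fun y' =>
      (Dist.empirical y').l1 (flowStep P h (Dist.empirical y))) ≤
      (2 * √(Fintype.card X : ℝ) + L_P * √(Fintype.card U : ℝ)) / √(N : ℝ) := by
  set m := Dist.empirical y
  set ν := actionDist m (h m)
  have hflow : flowStep P h m =
      Dist.mixture fun j => (h m (y j)).bind fun a => P (y j) m a ν := by
    rw [flowStep, Dist.bind_joint]
    exact Dist.bind_empirical y fun x => (h m x).bind fun a => P x m a ν
  have hmix : (profileActions h y).expect (fun u =>
      (Dist.mixture fun j => P (y j) m (u j) ν).l1 (flowStep P h m)) ≤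
      √(Fintype.card X : ℝ) / √(N : ℝ) := by
    rw [hflow]
    exact Dist.expect_l1_mixture_le _ fun j a => P (y j) m a ν
  -- Three errors: sampling the next states, replacing the empirical action law by `ν` (cost `L_P`),
  -- and averaging over the sampled actions. The first and third each contribute `√|X| / √N`.
  have hstep : ∀ u, (profileNext P (y, u)).expect (fun y' =>
      (Dist.empirical y').l1 (flowStep P h m)) ≤
      √(Fintype.card X : ℝ) / √(N : ℝ) + (L_P * (Dist.empirical u).l1 ν +
        (Dist.mixture fun j => P (y j) m (u j) ν).l1 (flowStep P h m)) := by
    intro u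
    set q : Dist X := Dist.mixture fun j => P (y j) m (u j) (Dist.empirical u)
    have hq : q.l1 (Dist.mixture fun j => P (y j) m (u j) ν) ≤ L_P * (Dist.empirical u).l1 ν :=
      Dist.l1_mixture_le fun j => (hP (y j) (u j) m m (Dist.empirical u) ν).trans_eq (by
        rw [Dist.l1_self, zero_add])
    calc _ ≤ (profileNext P (y, u)).expect fun y' =>
          (Dist.empirical y').l1 q + (L_P * (Dist.empirical u).l1 ν +
            (Dist.mixture fun j => P (y j) m (u j) ν).l1 (flowStep P h m)) :=
          Dist.expect_mono _ fun y' => (Dist.l1_triangle _ q _).trans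
            (add_le_add le_rfl ((Dist.l1_triangle _ _ _).trans (add_le_add hq le_rfl)))
      _ ≤ _ := by
          rw [Dist.expect_add, Dist.expect_const]
          exact add_le_add (Dist.expect_l1_empirical_le _) le_rfl
  refine (Dist.expect_mono _ hstep).trans ?_
  rw [Dist.expect_add, Dist.expect_add, Dist.expect_const, Dist.expect_const_mul]
  have h1 := mul_le_mul_of_nonneg_left (expect_l1_empirical_action_le h y) hL_P
  calc _ ≤ √(Fintype.card X : ℝ) / √(N : ℝ) + (L_P * (√(Fintype.card U : ℝ) / √(N : ℝ)) +
        √(Fintype.card X : ℝ) / √(N : ℝ)) := add_le_add le_rfl (add_le_add h1 hmix)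
    _ = _ := by ring

theorem abs_profileReward_sub_le (hL_r : 0 ≤ L_r) (hr : RewardRegular R L_r r) (y : Fin N → X) :
    |profileReward r h y - flowReward r h (Dist.empirical y)| ≤
      L_r * (√(Fintype.card U : ℝ) / √(N : ℝ)) := by
  have hN : (0 : ℝ) < N := Nat.cast_pos.2 (NeZero.pos N)
  set m := Dist.empirical y with hm
  set ν := actionDist m (h m) with hν
  -- With the action law frozen at `ν`, each summand involves one agent's action, so single-agent
  -- marginals suffice.
  have hflow : flowReward r h m =
      (profileActions h y).expect fun u => (∑ j, r (y j) m (u j) ν) / N := by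
    simp only [flowReward, ← hν, Dist.expect_joint, div_eq_inv_mul, Dist.expect_const_mul,
      Dist.expect_sum]
    rw [hm, Dist.expect_empirical, ← hm, div_eq_inv_mul]
    congr 1
    exact Finset.sum_congr rfl fun j _ =>
      (Dist.expect_indep_apply (fun j => h m (y j)) j fun a => r (y j) m a ν).symm
  rw [hflow, profileReward, ← Dist.expect_sub]
  have hle : ∀ u : Fin N → U, |(∑ j, r (y j) m (u j) (Dist.empirical u)) / N -
      (∑ j, r (y j) m (u j) ν) / N| ≤ L_r * (Dist.empirical u).l1 ν := by
    intro u
    rw [← sub_div, ← Finset.sum_sub_distrib, abs_div, abs_of_pos hN, div_le_iff₀ hN]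
    refine (Finset.abs_sum_le_sum_abs _ _).trans
      ((Finset.sum_le_sum (g := fun _ => L_r * (Dist.empirical u).l1 ν) fun j _ => ?_).trans_eq
        (by simp [mul_comm]))
    simpa [Dist.l1_self] using (hr (y j) (u j) m m (Dist.empirical u) ν).2
  calc _ ≤ (profileActions h y).expect fun u => L_r * (Dist.empirical u).l1 ν :=
        Dist.abs_expect_le_expect _ hle
    _ ≤ _ := by
        rw [Dist.expect_const_mul]
        exact mul_le_mul_of_nonneg_left (expect_l1_empirical_action_le h y) hL_r

/-- The empirical distribution of `N` agents stays close to the mean-field flow. -/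
theorem expect_l1_profileLaw_le {L : ℝ} {π : Policy X U} (hL_P : 0 < L_P) (hL : 0 < L)
    (hP : TransitionLipschitz L_P P) (hπ : PolicyLipschitz L π) (x : Fin N → X) (t : ℕ) :
    (profileLaw P π x t).expect (fun y =>
      (Dist.empirical y).l1 (stateFlow P π (Dist.empirical x) t)) *
        ((2 * L_P + 1) * (1 + L) - 1) ≤
      (2 * √(Fintype.card X : ℝ) + L_P * √(Fintype.card U : ℝ)) / √(N : ℝ) *
        (((2 * L_P + 1) * (1 + L)) ^ t - 1) := by
  set c := (2 * √(Fintype.card X : ℝ) + L_P * √(Fintype.card U : ℝ)) / √(N : ℝ)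
  set S := (2 * L_P + 1) * (1 + L) with hS
  have hS1 : 0 < S - 1 := by nlinarith [mul_pos hL_P hL]
  induction t with
  | zero =>
    change (Dist.dirac x).expect (fun y => (Dist.empirical y).l1 (Dist.empirical x)) * _ ≤ _
    simp [Dist.expect_dirac, Dist.l1_self]
  | succ t ih =>
    set μ := stateFlow P π (Dist.empirical x) t with hμ
    have hrec : (profileLaw P π x (t + 1)).expect (fun y =>
        (Dist.empirical y).l1 (stateFlow P π (Dist.empirical x) (t + 1))) =
        (profileLaw P π x t).expect fun y => (profileActions (π t) y).expect fun u =>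
          (profileNext P (y, u)).expect fun y' =>
            (Dist.empirical y').l1 (flowStep P (π t) μ) :=
      (Dist.expect_bind _ _ _).trans (Dist.expect_joint _ _ _)
    -- The recursion `e (t + 1) ≤ c + S * e t` with `e 0 = 0`; it sums to a geometric series, kept
    -- multiplied by `S - 1`.
    have hle : (profileLaw P π x (t + 1)).expect (fun y =>
        (Dist.empirical y).l1 (stateFlow P π (Dist.empirical x) (t + 1))) ≤
        c + S * (profileLaw P π x t).expect fun y => (Dist.empirical y).l1 μ := by
      rw [hrec, ← Dist.expect_const (profileLaw P π x t) c, ← Dist.expect_const_mul,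
        ← Dist.expect_add]
      refine Dist.expect_mono _ fun y => ?_
      calc _ ≤ (profileActions (π t) y).expect (fun u => (profileNext P (y, u)).expect fun y' =>
            (Dist.empirical y').l1 (flowStep P (π t) (Dist.empirical y)) +
              S * (Dist.empirical y).l1 μ) :=
            Dist.expect_mono _ fun u => Dist.expect_mono _ fun y' =>
              (Dist.l1_triangle _ _ _).trans
                (add_le_add le_rfl (l1_flowStep_le hL_P.le hL.le hP (hπ t) _ _))
        _ ≤ _ := by
            simp only [Dist.expect_add, Dist.expect_const]
            exact add_le_add (expect_l1_profileNext_le (π t) hL_P.le hP y) le_rfl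
    have hS0 : 0 ≤ S := by linarith
    calc _ ≤ (c + S * (profileLaw P π x t).expect fun y => (Dist.empirical y).l1 μ) * (S - 1) :=
          mul_le_mul_of_nonneg_right hle hS1.le
      _ = c * (S - 1) + S * ((profileLaw P π x t).expect (fun y => (Dist.empirical y).l1 μ) *
          (S - 1)) := by ring
      _ ≤ c * (S - 1) + S * (c * (S ^ t - 1)) := add_le_add le_rfl
          (mul_le_mul_of_nonneg_left ih hS0)
      _ = _ := by ring

end Profile

/-! ### Summing the errors over time -/

section ValueGap

variable {X U : Type*} [Fintype X] [Fintype U] [MeasurableSpace X] [MeasurableSingletonClass X]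
  [MeasurableSpace U] [MeasurableSingletonClass U] [DecidableEq X] [DecidableEq U]
  {N : ℕ} [NeZero N]

/-- The constant of the mean-field approximation. -/
def valueGapConst (L_P L_r L R γ : ℝ) : ℝ :=
  L_r / (1 - γ) + (R * (1 + L) + L_r * (2 + L)) * (2 + L_P) /
    (((2 * L_P + 1) * (1 + L) - 1) * (1 - γ * (2 * L_P + 1) * (1 + L)))

/-- For a Lipschitz policy the `N`-agent value is within `O(1 / √N)` of the mean-field value. -/
theorem abs_mfcValue_sub_marlValue_le {P : X → Dist X → U → Dist U → Dist X}
    {r : X → Dist X → U → Dist U → ℝ} {π : Policy X U} {L_P L_r L R γ : ℝ}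
    (hL_P : 0 < L_P) (hL_r : 0 < L_r) (hL : 0 < L) (hR : 0 < R) (hγ : γ ∈ Set.Ioo (0 : ℝ) 1)
    (hcontr : γ * (2 * L_P + 1) * (1 + L) < 1) (hP : TransitionLipschitz L_P P)
    (hr : RewardRegular R L_r r) (hπ : PolicyLipschitz L π) (x : Fin N → X) :
    |mfcValue γ P r π (Dist.empirical x) - marlValue γ P r π x| ≤
      valueGapConst L_P L_r L R γ *
        (√(Fintype.card X : ℝ) + √(Fintype.card U : ℝ)) / √(N : ℝ) := by
  set S := (2 * L_P + 1) * (1 + L) with hS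
  have hS1 : 0 < S - 1 := by nlinarith [mul_pos hL_P hL]
  set B := (√(Fintype.card X : ℝ) + √(Fintype.card U : ℝ)) / √(N : ℝ) with hB
  set M := R * (1 + L) + L_r * (2 + L) with hM
  have hM0 : 0 ≤ M := by positivity
  have hB0 : 0 ≤ B := by positivity
  have hγS : γ * S < 1 := by rw [hS]; linarith
  have hγS0 : 0 ≤ γ * S := mul_nonneg hγ.1.le (by linarith)
  have hbdd : ∀ x μ u ν, |r x μ u ν| ≤ R := fun x μ u ν => (hr x u μ μ ν ν).1
  have hsum := (hasSum_marlValue P r π hγ.1.le hγ.2 hbdd x).sub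
    (hasSum_mfcValue P r π hγ.1.le hγ.2 hbdd (Dist.empirical x))
  have hdist : ∀ t, (profileLaw P π x t).expect (fun y =>
      (Dist.empirical y).l1 (stateFlow P π (Dist.empirical x) t)) ≤
      (2 + L_P) * B / (S - 1) * S ^ t := by
    intro t
    have h1 := expect_l1_profileLaw_le hL_P hL hP hπ x t
    rw [← hS] at h1
    rw [div_mul_eq_mul_div, le_div_iff₀ hS1]
    refine h1.trans (mul_le_mul ?_ (by linarith) ?_ (by positivity))
    · rw [hB, ← mul_div_assoc]
      gcongr
      nlinarith [Real.sqrt_nonneg (Fintype.card X : ℝ), Real.sqrt_nonneg (Fintype.card U : ℝ)]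
    · linarith [one_le_pow₀ (n := t) (show 1 ≤ S by linarith)]
  have hterm : ∀ t, |(profileLaw P π x t).expect (profileReward r (π t)) -
      flowReward r (π t) (stateFlow P π (Dist.empirical x) t)| ≤
      L_r * B + M * ((2 + L_P) * B / (S - 1) * S ^ t) := by
    intro t
    set μ := stateFlow P π (Dist.empirical x) t
    have hpt : ∀ y : Fin N → X, |profileReward r (π t) y - flowReward r (π t) μ| ≤
        L_r * B + M * (Dist.empirical y).l1 μ := fun y =>
      (abs_sub_le _ _ _).trans (add_le_add
        ((abs_profileReward_sub_le (π t) hL_r.le hr y).trans (by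
          rw [hB]
          gcongr
          linarith [Real.sqrt_nonneg (Fintype.card X : ℝ)]))
        (abs_flowReward_sub_le hL_r.le hR.le hr (hπ t) _ _))
    have hE : (profileLaw P π x t).expect (fun y => L_r * B + M * (Dist.empirical y).l1 μ) ≤
        L_r * B + M * ((2 + L_P) * B / (S - 1) * S ^ t) := by
      rw [Dist.expect_add, Dist.expect_const, Dist.expect_const_mul]
      exact add_le_add le_rfl (mul_le_mul_of_nonneg_left (hdist t) hM0)
    rw [← Dist.expect_const (profileLaw P π x t) (flowReward r (π t) μ), ← Dist.expect_sub]
    refine le_trans ?_ hE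
    exact Dist.abs_expect_le_expect _ hpt
  -- Here discounting must beat the error growth: the second series has ratio `γ * S < 1`.
  have hgeom : HasSum (fun t => γ ^ t * (L_r * B + M * ((2 + L_P) * B / (S - 1) * S ^ t)))
      ((1 - γ)⁻¹ * (L_r * B) + (1 - γ * S)⁻¹ * (M * ((2 + L_P) * B / (S - 1)))) := by
    refine (((hasSum_geometric_of_lt_one hγ.1.le hγ.2).mul_right (L_r * B)).add
      ((hasSum_geometric_of_lt_one hγS0 hγS).mul_right
        (M * ((2 + L_P) * B / (S - 1))))).congr_fun fun t => ?_
    rw [mul_pow γ S t]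
    ring
  have hfin := tsum_of_norm_bounded hgeom fun t => show
      ‖γ ^ t * (profileLaw P π x t).expect (profileReward r (π t)) -
        γ ^ t * flowReward r (π t) (stateFlow P π (Dist.empirical x) t)‖ ≤ _ by
    rw [← mul_sub, Real.norm_eq_abs, abs_mul, abs_of_nonneg (pow_nonneg hγ.1.le t)]
    exact mul_le_mul_of_nonneg_left (hterm t) (pow_nonneg hγ.1.le t)
  rw [hsum.tsum_eq, Real.norm_eq_abs, abs_sub_comm] at hfin
  refine hfin.trans_eq ?_
  have h1γ : 1 - γ ≠ 0 := by linarith [hγ.2]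
  have h1S : 1 - γ * S ≠ 0 := by linarith
  have hSne : S - 1 ≠ 0 := hS1.ne'
  rw [valueGapConst, ← hM, mul_assoc γ, ← hS,
    mul_div_assoc (L_r / (1 - γ) + M * (2 + L_P) / ((S - 1) * (1 - γ * S))), ← hB]
  field_simp

theorem valueGapConst_pos {L_P L_r L R γ : ℝ}
    (hL_P : 0 < L_P) (hL_r : 0 < L_r) (hL : 0 < L) (hR : 0 < R) (hγ : γ ∈ Set.Ioo (0 : ℝ) 1)
    (hcontr : γ * (2 * L_P + 1) * (1 + L) < 1) : 0 < valueGapConst L_P L_r L R γ := by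
  have hS1 : 0 < (2 * L_P + 1) * (1 + L) - 1 := by nlinarith [mul_pos hL_P hL]
  have h1 : 0 < 1 - γ := by linarith [hγ.2]
  have h2 : 0 < 1 - γ * (2 * L_P + 1) * (1 + L) := by linarith
  unfold valueGapConst
  positivity

end ValueGap

end MeanField

end

/-! ### Comparison of the optimal values -/

theorem mainTheorem7 (L_P L_r L_Pi R γ : ℝ) (hL_P : 0 < L_P) (hL_r : 0 < L_r) (hL_Pi : 0 < L_Pi)
    (hR : 0 < R) (hγ : γ ∈ Set.Ioo (0 : ℝ) 1) (hcontr : γ * (2 * L_P + 1) * (1 + L_Pi) < 1) :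
    ∃ K : ℝ, 0 < K ∧
      ∀ (X : Type*) (U : Type*) [Fintype X] [DecidableEq X] [MeasurableSpace X]
        [MeasurableSingletonClass X] [Fintype U] [DecidableEq U] [MeasurableSpace U]
        [MeasurableSingletonClass U]
        (P : X → MeanField.Dist X → U → MeanField.Dist U → MeanField.Dist X)
        (r : X → MeanField.Dist X → U → MeanField.Dist U → ℝ),
        MeanField.TransitionLipschitz L_P P → MeanField.RewardRegular R L_r r →
        ∀ Pol : Set (MeanField.Policy X U), Pol ⊆ MeanField.admissiblePolicies X U →
        ∀ (N : ℕ) [NeZero N] (x : Fin N → X),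
          (∃ π, MeanField.IsMFCOptimal γ P r Pol (MeanField.Dist.empirical x) π ∧
            MeanField.PolicyLipschitz L_Pi π) →
          (∃ π, MeanField.IsMARLOptimal γ P r Pol x π ∧ MeanField.PolicyLipschitz L_Pi π) →
          ∀ πStar πTilde : MeanField.Policy X U,
            MeanField.IsMFCOptimal γ P r Pol (MeanField.Dist.empirical x) πStar →
            MeanField.IsMARLOptimal γ P r Pol x πTilde →
            |MeanField.mfcValue γ P r πStar (MeanField.Dist.empirical x) -
                MeanField.marlValue γ P r πTilde x| ≤
              K * (√(Fintype.card X : ℝ) + √(Fintype.card U : ℝ)) / √(N : ℝ) := by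
  refine ⟨MeanField.valueGapConst L_P L_r L_Pi R γ,
    MeanField.valueGapConst_pos hL_P hL_r hL_Pi hR hγ hcontr, ?_⟩
  rintro X U _ _ _ _ _ _ _ _ P r hP hr Pol - N _ x ⟨π₁, hπ₁, hLip₁⟩ ⟨π₂, hπ₂, hLip₂⟩
    πStar πTilde hStar hTilde
  have h₁ := abs_le.1 (MeanField.abs_mfcValue_sub_marlValue_le hL_P hL_r hL_Pi hR hγ hcontr
    hP hr hLip₁ x)
  have h₂ := abs_le.1 (MeanField.abs_mfcValue_sub_marlValue_le hL_P hL_r hL_Pi hR hγ hcontr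
    hP hr hLip₂ x)
  -- `e₁` and `e₃` with the gap for `π₁` bound the mean-field optimum from above; `e₂` and `e₄` with
  -- the gap for `π₂` give the reverse. `πStar` and `πTilde` themselves need not be Lipschitz.
  have e₁ := hπ₁.2 πStar hStar.1
  have e₂ := hπ₂.2 πTilde hTilde.1
  have e₃ := hTilde.2 π₁ hπ₁.1
  have e₄ := hStar.2 π₂ hπ₂.1
  rw [abs_le]
  constructor <;> linarith [h₁.1, h₁.2, h₂.1, h₂.2]
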